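/- Let $A_0,A_1\in\mathbb R^{n\times n}$, $B\in\mathbb R^{n\times m}$ and let $\bar h\ge 1$ be an integer. Consider the delay system $$x(k+1)=A_0x(k)+A_1x(k-h_1(k))+Bu(k-h_2(k)),\qquad k\ge 0 .\tag{1}$$ **Data.** For some $T>\bar h$, sequences $x=x^{\rm nom}+x^\delta$ and $u=u^{\rm nom}+u^\delta$ are recorded on $[-\bar h,T]$, where $(x^{\rm nom},u^{\rm nom})$ satisfies (1) for $k=0,\dots,T-1$ with constant delays $h_1,h_2\in\{0,\dots,\bar h\}$, and $x^\delta,u^\delta$ is additive noise. Put $X_0=[x(0)\cdots x(T-1)]$, $X_1=[x(1)\cdots x(T)]$, $X_{h_1}=[x(-h_1)\cdots x(T-1-h_1)]$, $U_{h_2}=[u(-h_2)\cdots u(T-1-h_2)]$, $W_0=[U_{h_2}^\top\; X_{h_1}^\top\; X_0^\top]^\top$, and let $X_1^\delta$, $W_0^\delta$ be the same matrices built from the noise. Assume that $\operatorname{rank}W_0=m+2n$ and that $$\Delta=[\,B\;A_1\;A_0\,]\,W_0^\delta-X_1^\delta\quad\text{satisfies}\quad\|\Delta\|_2\le\alpha,\qquad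 \alpha>0 .$$ **Matrix inequalities.** Let $\varepsilon>0$, and suppose that there are $n\times n$ matrices $\bar P>0$, $\bar S>0$, $\bar R_i>0$ and $\bar S_{12,i}$ ($i=1,2$), $T\times n$ matrices $Q_1,Q_2,Q_3$, and $\lambda>0$ such that $$\begin{bmatrix}\bar\Phi-\alpha^2\lambda I_{5n}&\mathbf Q^\top\\ \mathbf Q&\lambda I_{5T}\end{bmatrix}>0,\qquad \begin{bmatrix}\bar R_i&\bar S_{12,i}\\ \bar S_{12,i}^\top&\bar R_i\end{bmatrix}\ge0\quad(i=1,2),$$ $$U_{h_2}Q_2=U_{h_2}Q_3=0,\quad X_{h_1}Q_1=X_{h_1}Q_3=0,\quad X_0Q_1=X_0Q_2=0,\quad X_{h_1}Q_2=X_0Q_3 .$$ Here $M>0$ ($M\ge 0$) means that $M$ is symmetric positive definite (semidefinite), $$\mathbf Q=\begin{bmatrix}Q_3&Q_2&Q_1&0&0\\0&0&0&0&0\\0&0&0&0&0\\0&0&0&0&0\\ \varepsilon Q_3&\varepsilon Q_2&\varepsilon Q_1&0&0\end{bmatrix},$$ and $\bar\Phi$ is the symmetric $5\times5$ block matrix with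 blocks on and above the diagonal $$\begin{aligned} \bar\Phi_{11}&=\bar P-\bar S+(1-\bar h^2)(\bar R_1+\bar R_2)-X_1Q_3-(X_1Q_3)^\top,\\ \bar\Phi_{12}&=-\bar R_1+\bar S_{12,1}-X_1Q_2,\quad \bar\Phi_{13}=-\bar R_2+\bar S_{12,2}-X_1Q_1,\quad \bar\Phi_{14}=-\bar S_{12,1}-\bar S_{12,2},\\ \bar\Phi_{15}&=\bar h^2(\bar R_1+\bar R_2)+X_0Q_3-\varepsilon(X_1Q_3)^\top,\\ \bar\Phi_{22}&=2\bar R_1-\bar S_{12,1}-\bar S_{12,1}^\top,\quad \bar\Phi_{23}=0,\quad \bar\Phi_{24}=-\bar R_1+\bar S_{12,1},\quad \bar\Phi_{25}=-\varepsilon(X_1Q_2)^\top,\\ \bar\Phi_{33}&=2\bar R_2-\bar S_{12,2}-\bar S_{12,2}^\top,\quad \bar\Phi_{34}=-\bar R_2+\bar S_{12,2},\quad \bar\Phi_{35}=-\varepsilon(X_1Q_1)^\top,\\ \bar\Phi_{44}&=\bar R_1+\bar R_2+\bar S,\quad \bar\Phi_{45}=0,\\ \bar\Phi_{55}&=-\bar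 P-\bar h^2(\bar R_1+\bar R_2)+\varepsilon\big(X_0Q_3+Q_3^\top X_0^\top\big). \end{aligned}$$ **Conclusion.** Then $X_0Q_3$ is invertible, and with the gain $K=U_{h_2}Q_1(X_0Q_3)^{-1}$ the origin of (1) in closed loop with $u(k)=Kx(k)$ is exponentially stable for all, possibly time-varying, integer delays $h_1(k),h_2(k)\in[0,\bar h]$: there are $M>0$ and $\rho\in(0,1)$ such that, for all such delays, for all initial data $x(j),u(j)$, $-\bar h\le j\le 0$ (in particular for zero past inputs), and for all $k\ge0$, the solution of (1) with $u(k)=Kx(k)$ for $k\ge 1$ satisfies $$\|x(k)\|_2\le M\rho^k\max_{-\bar h\le j\le0}\max\{\|x(j)\|_2,\|u(j)\|_2\}.$$ -/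

import Mathlib

open scoped Matrix

noncomputable section

namespace DelayControl

/-- The Euclidean norm `√(vᵀ v)` of a real column vector. -/
def euclNorm {n : ℕ} (v : Fin n → ℝ) : ℝ := Real.sqrt (v ⬝ᵥ v)

open scoped Matrix.Norms.L2Operator in
/-- The matrix norm induced by the Euclidean norms. -/
def specNorm {p q : Type*} [Fintype p] [Fintype q] [DecidableEq q] (A : Matrix p q ℝ) : ℝ := ‖A‖

/-! ### Recorded data -/

/-- The data matrix `[z(i) z(i+1) ⋯ z(T+i-1)]` of a signal `z`. -/
def dataMat {n : ℕ} (z : ℤ → Fin n → ℝ) (i : ℤ) (T : ℕ) : Matrix (Fin n) (Fin T) ℝ :=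
  Matrix.of fun r c => z (i + ((c : ℕ) : ℤ)) r

/-- The delayed signal `k ↦ z(k - h)` for a constant delay `h`. -/
def delayed {n : ℕ} (z : ℤ → Fin n → ℝ) (h : ℕ) : ℤ → Fin n → ℝ := fun k => z (k - (h : ℤ))

/-- The stacked data matrix with block rows `u(k - h₂)`, `x(k - h₁)`, `x(k)`, `k = 0, …, T - 1`. -/
def dataW {n m : ℕ} (u : ℤ → Fin m → ℝ) (x : ℤ → Fin n → ℝ) (h₁ h₂ T : ℕ) :
    Matrix (Fin m ⊕ (Fin n ⊕ Fin n)) (Fin T) ℝ :=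
  Matrix.fromRows (dataMat (delayed u h₂) 0 T)
    (Matrix.fromRows (dataMat (delayed x h₁) 0 T) (dataMat x 0 T))

/-- The block row `[B A₁ A₀]`. -/
def sysMat {n m : ℕ} (A₀ A₁ : Matrix (Fin n) (Fin n) ℝ) (B : Matrix (Fin n) (Fin m) ℝ) :
    Matrix (Fin n) (Fin m ⊕ (Fin n ⊕ Fin n)) ℝ :=
  Matrix.fromCols B (Matrix.fromCols A₁ A₀)

/-- On the recording window `k = 0, …, T - 1` the signals `x`, `u` satisfy
`x(k+1) = A₀ x(k) + A₁ x(k - h₁) + B u(k - h₂)` with constant delays. -/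
def IsTrajectoryOn {n m : ℕ} (A₀ A₁ : Matrix (Fin n) (Fin n) ℝ) (B : Matrix (Fin n) (Fin m) ℝ)
    (h₁ h₂ T : ℕ) (x : ℤ → Fin n → ℝ) (u : ℤ → Fin m → ℝ) : Prop :=
  ∀ k : ℕ, k < T →
    x ((k : ℤ) + 1) = A₀ *ᵥ x k + A₁ *ᵥ x ((k : ℤ) - h₁) + B *ᵥ u ((k : ℤ) - h₂)

/-- The mismatch `Δ = [B A₁ A₀] W₀^δ - X₁^δ` of the noise signals `xδ`, `uδ`. -/
def mismatch {n m : ℕ} (A₀ A₁ : Matrix (Fin n) (Fin n) ℝ) (B : Matrix (Fin n) (Fin m) ℝ)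
    (h₁ h₂ T : ℕ) (xδ : ℤ → Fin n → ℝ) (uδ : ℤ → Fin m → ℝ) : Matrix (Fin n) (Fin T) ℝ :=
  sysMat A₀ A₁ B * dataW uδ xδ h₁ h₂ T - dataMat xδ 1 T

/-! ### The matrix inequality -/

/-- The `5n × 5n` matrix `Φ̄`, with `X₀`, `X₁` the data matrices of `x(k)`, `x(k+1)`. -/
def Phi {n T : ℕ} (hbar : ℕ) (ε : ℝ) (X₀ X₁ : Matrix (Fin n) (Fin T) ℝ)
    (P S R₁ R₂ S₁ S₂ : Matrix (Fin n) (Fin n) ℝ) (Q₁ Q₂ Q₃ : Matrix (Fin T) (Fin n) ℝ) :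
    Matrix (Fin 5 × Fin n) (Fin 5 × Fin n) ℝ :=
  let F₁₁ := P - S + (1 - (hbar : ℝ) ^ 2) • (R₁ + R₂) - X₁ * Q₃ - (X₁ * Q₃)ᵀ
  let F₁₂ := -R₁ + S₁ - X₁ * Q₂
  let F₁₃ := -R₂ + S₂ - X₁ * Q₁
  let F₁₄ := -S₁ - S₂
  let F₁₅ := (hbar : ℝ) ^ 2 • (R₁ + R₂) + X₀ * Q₃ - ε • (X₁ * Q₃)ᵀ
  let F₂₂ := (2 : ℝ) • R₁ - S₁ - S₁ᵀ
  let F₂₄ := -R₁ + S₁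
  let F₂₅ := -(ε • (X₁ * Q₂)ᵀ)
  let F₃₃ := (2 : ℝ) • R₂ - S₂ - S₂ᵀ
  let F₃₄ := -R₂ + S₂
  let F₃₅ := -(ε • (X₁ * Q₁)ᵀ)
  let F₄₄ := R₁ + R₂ + S
  let F₅₅ := -P - (hbar : ℝ) ^ 2 • (R₁ + R₂) + ε • (X₀ * Q₃ + Q₃ᵀ * X₀ᵀ)
  Matrix.comp (Fin 5) (Fin 5) (Fin n) (Fin n) ℝ
    !![F₁₁,  F₁₂,  F₁₃,  F₁₄,  F₁₅;
       F₁₂ᵀ, F₂₂,  0,    F₂₄,  F₂₅;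
       F₁₃ᵀ, 0,    F₃₃,  F₃₄,  F₃₅;
       F₁₄ᵀ, F₂₄ᵀ, F₃₄ᵀ, F₄₄,  0;
       F₁₅ᵀ, F₂₅ᵀ, F₃₅ᵀ, 0,    F₅₅]

/-- The `5T × 5n` matrix `𝐐`. Its last block row carries the factor `ε`, so that
`diag(Δ,Δ,Δ,Δ,Δ) 𝐐` is the contribution of the mismatch `Δ` weighted by `x(k) + ε x(k+1)`. -/
def bigQ {n T : ℕ} (ε : ℝ) (Q₁ Q₂ Q₃ : Matrix (Fin T) (Fin n) ℝ) :
    Matrix (Fin 5 × Fin T) (Fin 5 × Fin n) ℝ :=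
  Matrix.comp (Fin 5) (Fin 5) (Fin T) (Fin n) ℝ
    !![Q₃,     Q₂,     Q₁,     0, 0;
       0,      0,      0,      0, 0;
       0,      0,      0,      0, 0;
       0,      0,      0,      0, 0;
       ε • Q₃, ε • Q₂, ε • Q₁, 0, 0]

/-- The augmented matrix `[Φ̄ - α²λ I, 𝐐ᵀ; 𝐐, λ I]`. -/
def augmented {n T : ℕ} (α lam : ℝ) (F : Matrix (Fin 5 × Fin n) (Fin 5 × Fin n) ℝ)
    (Q : Matrix (Fin 5 × Fin T) (Fin 5 × Fin n) ℝ) :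
    Matrix ((Fin 5 × Fin n) ⊕ (Fin 5 × Fin T)) ((Fin 5 × Fin n) ⊕ (Fin 5 × Fin T)) ℝ :=
  Matrix.fromBlocks (F - (α ^ 2 * lam) • 1) Qᵀ Q (lam • 1)

/-! ### The closed loop -/

/-- `x`, `u` is a solution for `k ≥ 0` of
`x(k+1) = A₀ x(k) + A₁ x(k - η₁(k)) + B u(k - η₂(k))` with feedback `u(k) = K x(k)`.
The values of `x` and `u` at the times `j ≤ 0` are initial data; the feedback acts from `k = 1` on.
Past inputs `u(j) = 0` and past inputs `u(j) = K x(j)` are special cases. -/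
def IsClosedLoopSolution {n m : ℕ} (A₀ A₁ : Matrix (Fin n) (Fin n) ℝ)
    (B : Matrix (Fin n) (Fin m) ℝ) (K : Matrix (Fin m) (Fin n) ℝ) (η₁ η₂ : ℕ → ℕ)
    (x : ℤ → Fin n → ℝ) (u : ℤ → Fin m → ℝ) : Prop :=
  (∀ k : ℕ, x ((k : ℤ) + 1) =
      A₀ *ᵥ x k + A₁ *ᵥ x ((k : ℤ) - η₁ k) + B *ᵥ u ((k : ℤ) - η₂ k)) ∧
  (∀ k : ℤ, 0 < k → u k = K *ᵥ x k)

/-- The maximum of `‖z(j)‖₂` over the initial interval `j = -h̄, …, 0`. -/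
def histNorm {n : ℕ} (hbar : ℕ) (z : ℤ → Fin n → ℝ) : ℝ :=
  (Finset.range (hbar + 1)).sup' Finset.nonempty_range_add_one fun j => euclNorm (z (-(j : ℤ)))

/-- The origin of the closed loop is exponentially stable, with constants `M`, `ρ` that serve
all (time-varying) delays with values in `[0, h̄]` and all initial data. -/
def ExpStable {n m : ℕ} (A₀ A₁ : Matrix (Fin n) (Fin n) ℝ) (B : Matrix (Fin n) (Fin m) ℝ)
    (K : Matrix (Fin m) (Fin n) ℝ) (hbar : ℕ) : Prop :=
  ∃ M ρ : ℝ, 0 < M ∧ 0 < ρ ∧ ρ < 1 ∧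
    ∀ η₁ η₂ : ℕ → ℕ, (∀ k, η₁ k ≤ hbar) → (∀ k, η₂ k ≤ hbar) →
      ∀ (x : ℤ → Fin n → ℝ) (u : ℤ → Fin m → ℝ), IsClosedLoopSolution A₀ A₁ B K η₁ η₂ x u →
        ∀ k : ℕ, euclNorm (x k) ≤ M * ρ ^ k * max (histNorm hbar x) (histNorm hbar u)

end DelayControl

end

/-!
By the data identity, `X₁ + Δ = A₀ X₀ + A₁ Xₕ + B U`. Congruence of the augmented matrix with
`[I, -diag(Δ, …, Δ)]`, together with `‖Δ‖ ≤ α`, shows that `Φ̄` stays positive definite when `X₁` is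
replaced by `X₁ + Δ`. The equality constraints then say `(X₁ + Δ) Q₃ = A₀ F`, `(X₁ + Δ) Q₂ = A₁ F`
and `(X₁ + Δ) Q₁ = B K F` with `F = X₀ Q₃`, so that for `ξ = F⁻¹ x` the closed loop annihilates the
descriptor term `2 (ξ(k) + ε ξ(k+1))ᵀ (F ξ(k+1) - …)` in the quadratic form of `Φ̄`. What remains
is, by the reciprocally convex inequality, a lower bound for the decrease of a Krasovskii
functional, uniform in the delays. Adding a small weighted sum of the past values `‖ξ‖²` to the
functional makes the decrease proportional to its size, hence geometric. A crude growth bound covers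
the first `h̄ + 1` steps, in which the inputs need not yet come from the feedback.
-/

namespace DelayControl

section QuadraticForm

variable {ι κ : Type*} [Fintype ι] [Fintype κ]

theorem dotProduct_self_eq_norm_sq (v : ι → ℝ) : v ⬝ᵥ v = ‖WithLp.toLp 2 v‖ ^ 2 := by
  rw [EuclideanSpace.real_norm_sq_eq]
  simp only [dotProduct, sq]

theorem dotProduct_self_nonneg (v : ι → ℝ) : 0 ≤ v ⬝ᵥ v := by
  rw [dotProduct_self_eq_norm_sq]
  positivity

theorem sub_dotProduct_self_le (v w : ι → ℝ) :
    (v - w) ⬝ᵥ (v - w) ≤ 2 * (v ⬝ᵥ v + w ⬝ᵥ w) := by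
  have h := dotProduct_self_nonneg (v + w)
  simp only [add_dotProduct, sub_dotProduct, dotProduct_add, dotProduct_sub] at h ⊢
  linarith

theorem dotProduct_self_le_uncurry (b : ι → κ → ℝ) (i : ι) :
    b i ⬝ᵥ b i ≤ Function.uncurry b ⬝ᵥ Function.uncurry b := by
  rw [dotProduct, dotProduct, Fintype.sum_prod_type]
  exact Finset.single_le_sum (f := fun i => b i ⬝ᵥ b i)
    (fun j _ => dotProduct_self_nonneg (b j)) (Finset.mem_univ i)

theorem specNorm_nonneg [DecidableEq ι] (A : Matrix κ ι ℝ) : 0 ≤ specNorm A := by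
  rw [specNorm, Matrix.l2_opNorm_def]
  exact norm_nonneg _

theorem specNorm_transpose [DecidableEq ι] [DecidableEq κ] (A : Matrix κ ι ℝ) :
    specNorm Aᵀ = specNorm A := by
  rw [← Matrix.conjTranspose_eq_transpose_of_trivial]
  exact A.l2_opNorm_conjTranspose

theorem norm_toLp_mulVec_le [DecidableEq ι] (A : Matrix κ ι ℝ) (v : ι → ℝ) :
    ‖WithLp.toLp 2 (A *ᵥ v)‖ ≤ specNorm A * ‖WithLp.toLp 2 v‖ :=
  A.l2_opNorm_mulVec (WithLp.toLp 2 v)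

theorem mulVec_dotProduct_mulVec_le [DecidableEq ι] (A : Matrix κ ι ℝ) (v : ι → ℝ) :
    (A *ᵥ v) ⬝ᵥ (A *ᵥ v) ≤ specNorm A ^ 2 * (v ⬝ᵥ v) := by
  rw [dotProduct_self_eq_norm_sq, dotProduct_self_eq_norm_sq, ← mul_pow]
  exact pow_le_pow_left₀ (norm_nonneg _) (norm_toLp_mulVec_le A v) 2

/-- The value `vᵀ A v` of the quadratic form of the matrix `A`. -/
noncomputable def quadForm (A : Matrix ι ι ℝ) (v : ι → ℝ) : ℝ := v ⬝ᵥ A *ᵥ v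

theorem quadForm_add (A B : Matrix ι ι ℝ) (v : ι → ℝ) :
    quadForm (A + B) v = quadForm A v + quadForm B v := by
  simp only [quadForm, Matrix.add_mulVec, dotProduct_add]

theorem quadForm_le_specNorm_mul [DecidableEq ι] (A : Matrix ι ι ℝ) (v : ι → ℝ) :
    quadForm A v ≤ specNorm A * (v ⬝ᵥ v) :=
  calc quadForm A v = inner ℝ (WithLp.toLp 2 (A *ᵥ v)) (WithLp.toLp 2 v) := by
        rw [EuclideanSpace.inner_toLp_toLp, star_trivial, quadForm]
    _ ≤ ‖WithLp.toLp 2 (A *ᵥ v)‖ * ‖WithLp.toLp 2 v‖ := real_inner_le_norm _ _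
    _ ≤ specNorm A * ‖WithLp.toLp 2 v‖ * ‖WithLp.toLp 2 v‖ := by
        gcongr
        exact norm_toLp_mulVec_le A v
    _ = specNorm A * (v ⬝ᵥ v) := by
        rw [dotProduct_self_eq_norm_sq]
        ring

theorem quadForm_nonneg {A : Matrix ι ι ℝ} (hA : A.PosSemidef) (v : ι → ℝ) :
    0 ≤ quadForm A v := by
  simpa only [quadForm, star_trivial] using hA.dotProduct_mulVec_nonneg v

theorem quadForm_pos {A : Matrix ι ι ℝ} (hA : A.PosDef) {v : ι → ℝ} (hv : v ≠ 0) :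
    0 < quadForm A v := by
  simpa only [quadForm, star_trivial] using hA.dotProduct_mulVec_pos hv

open scoped Matrix.Norms.L2Operator MatrixOrder in
theorem exists_pos_mul_dotProduct_self_le_quadForm {A : Matrix ι ι ℝ} (hA : A.PosDef) :
    ∃ c : ℝ, 0 < c ∧ ∀ v, c * (v ⬝ᵥ v) ≤ quadForm A v := by
  classical
  cases isEmpty_or_nonempty ι
  · exact ⟨1, one_pos, fun v => by simp [quadForm]⟩
  obtain ⟨c, hc, hcA⟩ := (CFC.exists_pos_algebraMap_le_iff hA.isHermitian).2
    fun t ht => hA.isStrictlyPositive.spectrum_pos ht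
  refine ⟨c, hc, fun v => ?_⟩
  have h := quadForm_nonneg (Matrix.le_iff.1 hcA) v
  rwa [quadForm, Algebra.algebraMap_eq_smul_one, Matrix.sub_mulVec, Matrix.smul_mulVec,
    Matrix.one_mulVec, dotProduct_sub, dotProduct_smul, smul_eq_mul, sub_nonneg] at h

theorem dotProduct_mulVec_comm {A : Matrix ι ι ℝ} (hA : A.IsHermitian) (v w : ι → ℝ) :
    v ⬝ᵥ A *ᵥ w = w ⬝ᵥ A *ᵥ v := by
  conv_lhs => rw [← hA.eq, Matrix.conjTranspose_eq_transpose_of_trivial]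
  exact A.dotProduct_transpose_mulVec v w

theorem quadForm_comp_uncurry (M : Matrix ι ι (Matrix κ κ ℝ)) (b : ι → κ → ℝ) :
    quadForm (Matrix.comp ι ι κ κ ℝ M) (Function.uncurry b) =
      ∑ i, ∑ j, b i ⬝ᵥ M i j *ᵥ b j := by
  simp only [quadForm, dotProduct, Matrix.mulVec, Fintype.sum_prod_type, Function.uncurry,
    Matrix.comp_apply, Finset.mul_sum]
  exact Finset.sum_congr rfl fun i _ => Finset.sum_comm

end QuadraticForm

section ReciprocallyConvex

variable {ι κ σ : Type*} [Fintype ι] {R S : Matrix ι ι ℝ}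

theorem two_mul_dotProduct_mulVec_le_of_fromBlocks
    (h : (Matrix.fromBlocks R S Sᵀ R).PosSemidef) (v w : ι → ℝ) :
    2 * (v ⬝ᵥ S *ᵥ w) ≤ quadForm R v + quadForm R w := by
  have h := quadForm_nonneg h (Sum.elim v (-w))
  simp only [quadForm, Matrix.fromBlocks_mulVec, sumElim_dotProduct_sumElim, Sum.elim_comp_inl,
    Sum.elim_comp_inr, dotProduct_add, neg_dotProduct, Matrix.mulVec_neg, dotProduct_neg,
    Matrix.dotProduct_transpose_mulVec] at h
  simp only [quadForm]
  linarith

theorem two_mul_dotProduct_mulVec_le (hR : R.PosSemidef) (v w : ι → ℝ) :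
    2 * (v ⬝ᵥ R *ᵥ w) ≤ quadForm R v + quadForm R w := by
  have h := quadForm_nonneg hR (v - w)
  rw [quadForm, Matrix.mulVec_sub, sub_dotProduct, dotProduct_sub, dotProduct_sub,
    dotProduct_mulVec_comm hR.isHermitian w v] at h
  simp only [quadForm]
  linarith

theorem two_mul_sum_dotProduct_mulVec_sum_le
    (h : ∀ v w : ι → ℝ, 2 * (v ⬝ᵥ S *ᵥ w) ≤ quadForm R v + quadForm R w)
    (I : Finset κ) (J : Finset σ) (f : κ → ι → ℝ) (g : σ → ι → ℝ) :
    2 * ((∑ i ∈ I, f i) ⬝ᵥ S *ᵥ ∑ j ∈ J, g j) ≤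
      J.card * ∑ i ∈ I, quadForm R (f i) + I.card * ∑ j ∈ J, quadForm R (g j) :=
  calc 2 * ((∑ i ∈ I, f i) ⬝ᵥ S *ᵥ ∑ j ∈ J, g j)
      = ∑ i ∈ I, ∑ j ∈ J, 2 * (f i ⬝ᵥ S *ᵥ g j) := by
        simp only [Matrix.mulVec_sum, dotProduct_sum, sum_dotProduct, Finset.mul_sum]
        exact Finset.sum_comm
    _ ≤ ∑ i ∈ I, ∑ j ∈ J, (quadForm R (f i) + quadForm R (g j)) :=
        Finset.sum_le_sum fun i _ => Finset.sum_le_sum fun j _ => h (f i) (g j)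
    _ = J.card * ∑ i ∈ I, quadForm R (f i) + I.card * ∑ j ∈ J, quadForm R (g j) := by
        simp only [Finset.sum_add_distrib, Finset.sum_const, nsmul_eq_mul, Finset.mul_sum]

/-- The quadratic form of the block matrix `[R, S; Sᵀ, R]` with symmetric `R` at `(a, b)`. It is the
reciprocally convex lower bound for the sums of `vᵀ R v` over two adjacent windows whose increments
add up to `a` and to `b`. -/
noncomputable def recipForm (R S : Matrix ι ι ℝ) (a b : ι → ℝ) : ℝ :=
  quadForm R a + quadForm R b + 2 * (a ⬝ᵥ S *ᵥ b)

theorem recipForm_sum_le (h : (Matrix.fromBlocks R S Sᵀ R).PosSemidef)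
    (I : Finset κ) (J : Finset σ) (f : κ → ι → ℝ) (g : σ → ι → ℝ) :
    recipForm R S (∑ i ∈ I, f i) (∑ j ∈ J, g j) ≤
      (I.card + J.card) * (∑ i ∈ I, quadForm R (f i) + ∑ j ∈ J, quadForm R (g j)) := by
  have hR : R.PosSemidef := h.submatrix Sum.inl
  have hff := two_mul_sum_dotProduct_mulVec_sum_le (two_mul_dotProduct_mulVec_le hR) I I f f
  have hgg := two_mul_sum_dotProduct_mulVec_sum_le (two_mul_dotProduct_mulVec_le hR) J J g g
  have hfg := two_mul_sum_dotProduct_mulVec_sum_le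
    (two_mul_dotProduct_mulVec_le_of_fromBlocks h) I J f g
  rw [recipForm, quadForm, quadForm]
  linarith

theorem recipForm_le_sum (h : (Matrix.fromBlocks R S Sᵀ R).PosSemidef) (g : ℕ → ι → ℝ)
    {d N : ℕ} (hd : d ≤ N) :
    recipForm R S (g N - g d) (g d - g 0) ≤
      N * ∑ i ∈ Finset.range N, quadForm R (g (i + 1) - g i) := by
  obtain ⟨τ, rfl⟩ := Nat.exists_eq_add_of_le hd
  have key := recipForm_sum_le h (Finset.range τ) (Finset.range d)
    (fun i => g (d + (i + 1)) - g (d + i)) (fun i => g (i + 1) - g i)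
  rw [Finset.sum_range_sub (fun i => g (d + i)), Finset.sum_range_sub g, Finset.card_range,
    Finset.card_range, add_zero, add_comm (τ : ℝ), add_comm (Finset.sum _ _)] at key
  rw [Finset.sum_range_add, Nat.cast_add]
  exact key

end ReciprocallyConvex

section RobustInequality

open scoped Kronecker

theorem posDef_sub_mul_of_fromBlocks {ι κ : Type*} [Finite ι] [Fintype κ] [DecidableEq ι]
    [DecidableEq κ] {F : Matrix ι ι ℝ} {Q : Matrix κ ι ℝ} {E : Matrix ι κ ℝ} {α lam : ℝ}
    (hlam : 0 ≤ lam) (hE : (α ^ 2 • 1 - E * Eᵀ).PosSemidef)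
    (h : (Matrix.fromBlocks (F - (α ^ 2 * lam) • 1) Qᵀ Q (lam • 1)).PosDef) :
    (F - E * Q - (E * Q)ᵀ).PosDef := by
  cases nonempty_fintype ι
  have hcongr : (Matrix.fromCols (1 : Matrix ι ι ℝ) (-E) *
      Matrix.fromBlocks (F - (α ^ 2 * lam) • 1) Qᵀ Q (lam • 1) *
        (Matrix.fromCols (1 : Matrix ι ι ℝ) (-E))ᴴ).PosDef := by
    refine h.mul_mul_conjTranspose_same fun v w hvw => ?_
    simpa using congrArg (· ∘ Sum.inl) hvw
  have key := hcongr.add_posSemidef (hE.smul hlam)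
  convert key using 1
  rw [Matrix.conjTranspose_fromCols_eq_fromRows_conjTranspose, Matrix.fromCols_mul_fromBlocks,
    Matrix.fromCols_mul_fromRows]
  simp only [Matrix.transpose_mul, one_mul, Matrix.neg_mul,
    Matrix.conjTranspose_eq_transpose_of_trivial, Matrix.transpose_one, mul_one, Matrix.one_mul,
    Matrix.mul_smul, Matrix.mul_one, smul_neg, Matrix.transpose_neg, Matrix.mul_neg,
    Matrix.add_mul, Matrix.smul_mul, neg_add_rev, neg_neg, smul_sub, smul_smul, mul_comm lam]
  abel

theorem posSemidef_sq_smul_one_sub_mul_transpose {ι κ : Type*} [Fintype ι] [Fintype κ]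
    [DecidableEq ι] [DecidableEq κ] {D : Matrix ι κ ℝ} {α : ℝ} (hD : specNorm D ≤ α) :
    (α ^ 2 • 1 - D * Dᵀ).PosSemidef := by
  refine .of_dotProduct_mulVec_nonneg ?_ fun v => ?_
  · simp [Matrix.IsHermitian, Matrix.conjTranspose_eq_transpose_of_trivial]
  · have hle := (mulVec_dotProduct_mulVec_le Dᵀ v).trans <| mul_le_mul_of_nonneg_right
      (pow_le_pow_left₀ (specNorm_nonneg _) ((specNorm_transpose D).trans_le hD) 2)
      (dotProduct_self_nonneg v)
    rwa [star_trivial, Matrix.sub_mulVec, Matrix.smul_mulVec, Matrix.one_mulVec, dotProduct_sub,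
      dotProduct_smul, smul_eq_mul, ← Matrix.mulVec_mulVec, Matrix.dotProduct_mulVec v D,
      ← Matrix.mulVec_transpose, sub_nonneg]

theorem one_kronecker_mul_comp {ι σ τ υ : Type*} [Fintype ι] [DecidableEq ι] [Fintype τ]
    (D : Matrix σ τ ℝ) (M : Matrix ι ι (Matrix τ υ ℝ)) :
    (1 : Matrix ι ι ℝ) ⊗ₖ D * Matrix.comp ι ι τ υ ℝ M =
      Matrix.comp ι ι σ υ ℝ (M.map (D * ·)) := by
  ext ⟨i, s⟩ ⟨j, t⟩
  simp [Matrix.mul_apply, Fintype.sum_prod_type, Matrix.one_apply]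

theorem Phi_sub_kronecker_mul_bigQ {n T : ℕ} (hbar : ℕ) (ε : ℝ)
    (X₀ X₁ D : Matrix (Fin n) (Fin T) ℝ) (P S R₁ R₂ S₁ S₂ : Matrix (Fin n) (Fin n) ℝ)
    (Q₁ Q₂ Q₃ : Matrix (Fin T) (Fin n) ℝ) :
    Phi hbar ε X₀ X₁ P S R₁ R₂ S₁ S₂ Q₁ Q₂ Q₃ -
        (1 : Matrix (Fin 5) (Fin 5) ℝ) ⊗ₖ D * bigQ ε Q₁ Q₂ Q₃ -
        ((1 : Matrix (Fin 5) (Fin 5) ℝ) ⊗ₖ D * bigQ ε Q₁ Q₂ Q₃)ᵀ =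
      Phi hbar ε X₀ (X₁ + D) P S R₁ R₂ S₁ S₂ Q₁ Q₂ Q₃ := by
  rw [bigQ, one_kronecker_mul_comp, Phi, Phi]
  simp only [Matrix.add_mul]
  ext ⟨i, s⟩ ⟨j, t⟩
  simp only [Matrix.sub_apply, Matrix.comp_apply, Matrix.transpose_apply, Matrix.map_apply]
  generalize X₁ * Q₁ = Y₁, X₁ * Q₂ = Y₂, X₁ * Q₃ = Y₃
  fin_cases i <;> fin_cases j <;>
    simp only [Fin.zero_eta, Fin.mk_one, Fin.reduceFinMk, Matrix.of_apply, Matrix.cons_val',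
      Matrix.cons_val_zero, Matrix.cons_val_one, Matrix.cons_val, Matrix.cons_val_fin_one,
      Matrix.mul_zero, Matrix.mul_smul, Matrix.transpose_apply, Matrix.add_apply,
      Matrix.sub_apply, Matrix.neg_apply, Matrix.smul_apply, Matrix.zero_apply, smul_eq_mul] <;>
    ring

theorem posSemidef_sq_smul_one_sub_one_kronecker_mul_transpose {ι κ σ : Type*} [Fintype ι]
    [Fintype κ] [Fintype σ] [DecidableEq ι] [DecidableEq κ] [DecidableEq σ] {D : Matrix ι κ ℝ}
    {α : ℝ} (hD : specNorm D ≤ α) :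
    (α ^ 2 • 1 - (1 : Matrix σ σ ℝ) ⊗ₖ D * ((1 : Matrix σ σ ℝ) ⊗ₖ D)ᵀ).PosSemidef := by
  have hE : ((1 : Matrix σ σ ℝ) ⊗ₖ (α ^ 2 • 1 - D * Dᵀ)).PosSemidef :=
    Matrix.PosSemidef.one.kronecker (posSemidef_sq_smul_one_sub_mul_transpose hD)
  have hsplit : (1 : Matrix σ σ ℝ) ⊗ₖ (α ^ 2 • 1 - D * Dᵀ) =
      α ^ 2 • 1 - (1 : Matrix σ σ ℝ) ⊗ₖ D * ((1 : Matrix σ σ ℝ) ⊗ₖ D)ᵀ := by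
    rw [← Matrix.kroneckerMap_transpose, Matrix.transpose_one, ← Matrix.mul_kronecker_mul, mul_one,
      eq_sub_iff_add_eq, ← Matrix.kronecker_add, sub_add_cancel, Matrix.kronecker_smul,
      Matrix.one_kronecker_one]
  rwa [hsplit] at hE

theorem Phi_posDef_of_augmented_posDef {n T hbar : ℕ} {α ε lam : ℝ}
    {X₀ X₁ D : Matrix (Fin n) (Fin T) ℝ} {P S R₁ R₂ S₁ S₂ : Matrix (Fin n) (Fin n) ℝ}
    {Q₁ Q₂ Q₃ : Matrix (Fin T) (Fin n) ℝ} (hlam : 0 ≤ lam) (hD : specNorm D ≤ α)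
    (h : (augmented α lam (Phi hbar ε X₀ X₁ P S R₁ R₂ S₁ S₂ Q₁ Q₂ Q₃)
      (bigQ ε Q₁ Q₂ Q₃)).PosDef) :
    (Phi hbar ε X₀ (X₁ + D) P S R₁ R₂ S₁ S₂ Q₁ Q₂ Q₃).PosDef := by
  rw [← Phi_sub_kronecker_mul_bigQ]
  exact posDef_sub_mul_of_fromBlocks hlam
    (posSemidef_sq_smul_one_sub_one_kronecker_mul_transpose hD) h

end RobustInequality

section DescriptorForm

/-- The quantity that bounds from below the decrease of the Krasovskii functional over one step,
when `z`, `z₁`, `z₂`, `zh`, `y` are the states at the times `k`, `k - h₁`, `k - h₂`, `k - h`,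
`k + 1` for some delays `h₁`, `h₂` in `[0, h]`. -/
noncomputable def decreaseBound {ι : Type*} [Fintype ι] (h : ℕ) (P S R₁ R₂ S₁ S₂ : Matrix ι ι ℝ)
    (z z₁ z₂ zh y : ι → ℝ) : ℝ :=
  quadForm P z - quadForm P y - quadForm S z + quadForm S zh
    - (h : ℝ) ^ 2 * quadForm (R₁ + R₂) (y - z)
    + recipForm R₁ S₁ (z - z₁) (z₁ - zh) + recipForm R₂ S₂ (z - z₂) (z₂ - zh)

variable {n T h : ℕ} {ε : ℝ} {X₀ X₁ : Matrix (Fin n) (Fin T) ℝ}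
  {P S R₁ R₂ S₁ S₂ : Matrix (Fin n) (Fin n) ℝ} {Q₁ Q₂ Q₃ : Matrix (Fin T) (Fin n) ℝ}

theorem quadForm_Phi (hR₁ : R₁.IsHermitian) (hR₂ : R₂.IsHermitian) (z z₁ z₂ zh y : Fin n → ℝ) :
    quadForm (Phi h ε X₀ X₁ P S R₁ R₂ S₁ S₂ Q₁ Q₂ Q₃) (Function.uncurry ![z, z₁, z₂, zh, y]) =
      decreaseBound h P S R₁ R₂ S₁ S₂ z z₁ z₂ zh y +
        2 * ((z + ε • y) ⬝ᵥ ((X₀ * Q₃) *ᵥ y - (X₁ * Q₃) *ᵥ z - (X₁ * Q₂) *ᵥ z₁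
          - (X₁ * Q₁) *ᵥ z₂)) := by
  rw [Phi, quadForm_comp_uncurry, ← Matrix.transpose_mul]
  generalize X₀ * Q₃ = F, X₁ * Q₁ = N₁, X₁ * Q₂ = N₂, X₁ * Q₃ = N₃
  simp only [Fin.sum_univ_five, Matrix.of_apply, Matrix.cons_val', Matrix.cons_val_zero,
    Matrix.cons_val_one, Matrix.cons_val, Matrix.cons_val_fin_one]
  simp only [decreaseBound, recipForm, quadForm, dotProduct_add, add_dotProduct, dotProduct_sub,
    dotProduct_neg, sub_dotProduct, Matrix.mulVec_sub, Matrix.add_mulVec, Matrix.sub_mulVec,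
    Matrix.neg_mulVec, Matrix.smul_mulVec, dotProduct_smul, smul_dotProduct, smul_eq_mul,
    Matrix.zero_mulVec, dotProduct_zero, Matrix.transpose_add, Matrix.transpose_sub,
    Matrix.transpose_neg, Matrix.transpose_smul, Matrix.transpose_transpose,
    Matrix.dotProduct_transpose_mulVec]
  rw [dotProduct_mulVec_comm hR₁ y z, dotProduct_mulVec_comm hR₁ z₁ z,
    dotProduct_mulVec_comm hR₁ zh z₁, dotProduct_mulVec_comm hR₂ y z,
    dotProduct_mulVec_comm hR₂ z₂ z, dotProduct_mulVec_comm hR₂ zh z₂]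
  ring

theorem exists_pos_mul_le_decreaseBound (hR₁ : R₁.IsHermitian) (hR₂ : R₂.IsHermitian)
    (hPhi : (Phi h ε X₀ X₁ P S R₁ R₂ S₁ S₂ Q₁ Q₂ Q₃).PosDef) :
    ∃ c : ℝ, 0 < c ∧ ∀ z z₁ z₂ zh y : Fin n → ℝ,
      (X₀ * Q₃) *ᵥ y = (X₁ * Q₃) *ᵥ z + (X₁ * Q₂) *ᵥ z₁ + (X₁ * Q₁) *ᵥ z₂ →
        c * (z ⬝ᵥ z) ≤ decreaseBound h P S R₁ R₂ S₁ S₂ z z₁ z₂ zh y := by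
  obtain ⟨c, hc, hcPhi⟩ := exists_pos_mul_dotProduct_self_le_quadForm hPhi
  refine ⟨c, hc, fun z z₁ z₂ zh y hy => ?_⟩
  calc c * (z ⬝ᵥ z)
      ≤ c * (Function.uncurry ![z, z₁, z₂, zh, y] ⬝ᵥ Function.uncurry ![z, z₁, z₂, zh, y]) :=
        mul_le_mul_of_nonneg_left (dotProduct_self_le_uncurry ![z, z₁, z₂, zh, y] 0) hc.le
    _ ≤ quadForm (Phi h ε X₀ X₁ P S R₁ R₂ S₁ S₂ Q₁ Q₂ Q₃)
          (Function.uncurry ![z, z₁, z₂, zh, y]) := hcPhi _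
    _ = decreaseBound h P S R₁ R₂ S₁ S₂ z z₁ z₂ zh y := by
        rw [quadForm_Phi hR₁ hR₂, hy]
        simp only [sub_sub, sub_self, add_assoc, dotProduct_zero, mul_zero, add_zero]

theorem isUnit_of_Phi_posDef (hP : P.PosSemidef) (hR₁ : R₁.PosSemidef) (hR₂ : R₂.PosSemidef)
    (hPhi : (Phi h ε X₀ X₁ P S R₁ R₂ S₁ S₂ Q₁ Q₂ Q₃).PosDef) : IsUnit (X₀ * Q₃) := by
  rw [← Matrix.mulVec_injective_iff_isUnit, ← Matrix.coe_mulVecLin, injective_iff_map_eq_zero]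
  intro y hy
  by_contra hy₀
  have hne : Function.uncurry (![0, 0, 0, 0, y] : Fin 5 → Fin n → ℝ) ≠ 0 := fun h₀ =>
    hy₀ (funext fun s => congrFun h₀ (4, s))
  have hpos := quadForm_pos hPhi hne
  rw [quadForm_Phi hR₁.isHermitian hR₂.isHermitian, ← Matrix.mulVecLin_apply, hy] at hpos
  have hval : decreaseBound h P S R₁ R₂ S₁ S₂ 0 0 0 0 y =
      -(quadForm P y + (h : ℝ) ^ 2 * quadForm (R₁ + R₂) y) := by
    simp only [decreaseBound, recipForm, quadForm, Matrix.mulVec_zero, dotProduct_zero, zero_sub,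
      sub_zero, add_zero, sub_self, mul_zero]
    ring
  have hPy := quadForm_nonneg hP y
  have hRy := mul_nonneg (sq_nonneg (h : ℝ)) (quadForm_nonneg (hR₁.add hR₂) y)
  simp only [hval, Matrix.mulVec_zero, sub_zero, dotProduct_zero, mul_zero, add_zero] at hpos
  linarith

end DescriptorForm

section RampSum

/-- The double sum `∑_{k < h} ∑_{k ≤ i < h} f i`, with the order of summation exchanged. -/
noncomputable def rampSum (h : ℕ) (f : ℕ → ℝ) : ℝ := ∑ i ∈ Finset.range h, ((i : ℝ) + 1) * f i

theorem rampSum_shift (h : ℕ) (f : ℕ → ℝ) :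
    rampSum h (fun i => f (i + 1)) = rampSum h f + h * f h - ∑ i ∈ Finset.range h, f i := by
  induction h with
  | zero => simp [rampSum]
  | succ h ih =>
    simp only [rampSum, Finset.sum_range_succ] at ih ⊢
    push_cast
    linarith

theorem rampSum_nonneg (h : ℕ) {f : ℕ → ℝ} (hf : ∀ i, 0 ≤ f i) : 0 ≤ rampSum h f :=
  Finset.sum_nonneg fun i _ => mul_nonneg (by positivity) (hf i)

theorem rampSum_le (h : ℕ) {f : ℕ → ℝ} (hf : ∀ i, 0 ≤ f i) :
    rampSum h f ≤ h * ∑ i ∈ Finset.range h, f i := by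
  rw [rampSum, Finset.mul_sum]
  refine Finset.sum_le_sum fun i hi => mul_le_mul_of_nonneg_right ?_ (hf i)
  exact_mod_cast Finset.mem_range.1 hi

theorem le_mul_geom_of_le_sub_mul {W E : ℕ → ℝ} {μ D : ℝ} (hμ : 0 ≤ μ) (hμD : μ < D)
    (hstep : ∀ j, W (j + 1) ≤ W j - μ * E j) (hW : ∀ j, W j ≤ D * E j) (j : ℕ) :
    W j ≤ D * (1 - μ / D) ^ j * E 0 := by
  have hD : 0 < D := hμ.trans_lt hμD
  have hρ : 0 ≤ 1 - μ / D := sub_nonneg.2 ((div_le_one hD).2 hμD.le)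
  have hcontract (k : ℕ) : W (k + 1) ≤ (1 - μ / D) * W k := by
    have hE : μ / D * W k ≤ μ * E k := by
      rw [div_mul_eq_mul_div, div_le_iff₀ hD, mul_assoc, mul_comm (E k)]
      exact mul_le_mul_of_nonneg_left (hW k) hμ
    linarith [hstep k]
  calc W j ≤ (1 - μ / D) ^ j * W 0 := le_geom hρ j fun k _ => hcontract k
    _ ≤ (1 - μ / D) ^ j * (D * E 0) := by gcongr; exact hW 0
    _ = D * (1 - μ / D) ^ j * E 0 := by ring

theorem exists_geometric_decay (h : ℕ) {c C : ℝ} (hc : 0 < c) (hC : 0 < C) :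
    ∃ ρ : ℝ, 0 < ρ ∧ ρ < 1 ∧ ∀ V e : ℕ → ℝ, (∀ i, 0 ≤ e i) →
      (∀ j, V (j + 1) + c * e (j + h) ≤ V j) →
      (∀ j, V j ≤ C * ∑ i ∈ Finset.range (h + 1), e (j + i)) →
        ∀ j, V j ≤ (C + c) * ρ ^ j * ∑ i ∈ Finset.range (h + 1), e i := by
  set μ := c / (h + 1)
  have hμ : 0 < μ := by positivity
  have hμc : μ * h + μ = c := by simp only [μ]; field_simp
  have hμh : 0 ≤ μ * h := by positivity
  have hμC : μ < C + c := by linarith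
  refine ⟨1 - μ / (C + c), sub_pos.2 ((div_lt_one (by positivity)).2 hμC),
    sub_lt_self 1 (by positivity), fun V e he hstep hV j => ?_⟩
  set E : ℕ → ℝ := fun j => ∑ i ∈ Finset.range (h + 1), e (j + i)
  -- The ramp spreads the dissipation `c * e (j + h)` evenly over the whole window.
  set W : ℕ → ℝ := fun j => V j + μ * rampSum h (fun i => e (j + i))
  have hW_step (j : ℕ) : W (j + 1) ≤ W j - μ * E j := by
    have hshift := rampSum_shift h (fun i => e (j + i))
    simp only [W, E, Finset.sum_range_succ, add_right_comm j 1, add_assoc j _ 1]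
    rw [hshift]
    linarith [hstep j, congrArg (· * e (j + h)) hμc]
  have hW_le (j : ℕ) : W j ≤ (C + c) * E j := by
    have htail : ∑ i ∈ Finset.range h, e (j + i) ≤ E j :=
      Finset.sum_le_sum_of_subset_of_nonneg (Finset.range_mono h.le_succ) fun i _ _ => he (j + i)
    have hE : 0 ≤ E j := Finset.sum_nonneg fun i _ => he (j + i)
    have hramp : μ * rampSum h (fun i => e (j + i)) ≤ c * E j :=
      calc μ * rampSum h (fun i => e (j + i)) ≤ μ * (h * E j) := by
            gcongr
            exact (rampSum_le h fun i => he (j + i)).trans (by gcongr)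
        _ ≤ c * E j := by
            rw [← mul_assoc]
            gcongr
            linarith
    exact (add_le_add (hV j) hramp).trans_eq (add_mul C c (E j)).symm
  have hV_le : V j ≤ W j :=
    le_add_of_nonneg_right (mul_nonneg hμ.le (rampSum_nonneg h fun i => he (j + i)))
  simpa only [E, zero_add] using hV_le.trans (le_mul_geom_of_le_sub_mul hμ.le hμC hW_step hW_le j)

end RampSum

section Krasovskii

variable {ι : Type*} [Fintype ι] (h : ℕ)

/-- The Krasovskii functional `xᵀ P x + ∑ xᵀ S x + h ∑∑ ηᵀ R η` of the window `g 0, …, g h` of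
states, the present one being `g h`, with `η` the increments of `g`. -/
noncomputable def krasovskii (P S R : Matrix ι ι ℝ) (g : ℕ → ι → ℝ) : ℝ :=
  quadForm P (g h) + ∑ i ∈ Finset.range h, quadForm S (g i)
    + h * rampSum h fun i => quadForm R (g (i + 1) - g i)

variable {h} {P S R R₁ R₂ S₁ S₂ : Matrix ι ι ℝ}

theorem krasovskii_nonneg (hP : P.PosSemidef) (hS : S.PosSemidef) (hR : R.PosSemidef)
    (g : ℕ → ι → ℝ) : 0 ≤ krasovskii h P S R g :=
  add_nonneg (add_nonneg (quadForm_nonneg hP _) (Finset.sum_nonneg fun _ _ => quadForm_nonneg hS _))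
    (mul_nonneg h.cast_nonneg (rampSum_nonneg h fun _ => quadForm_nonneg hR _))

theorem krasovskii_shift_add_decreaseBound_le
    (hRC₁ : (Matrix.fromBlocks R₁ S₁ S₁ᵀ R₁).PosSemidef)
    (hRC₂ : (Matrix.fromBlocks R₂ S₂ S₂ᵀ R₂).PosSemidef) (g : ℕ → ι → ℝ) {d₁ d₂ : ℕ}
    (hd₁ : d₁ ≤ h) (hd₂ : d₂ ≤ h) :
    krasovskii h P S (R₁ + R₂) (fun i => g (i + 1)) +
        decreaseBound h P S R₁ R₂ S₁ S₂ (g h) (g d₁) (g d₂) (g 0) (g (h + 1)) ≤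
      krasovskii h P S (R₁ + R₂) g := by
  have hwindow₁ := recipForm_le_sum hRC₁ g hd₁
  have hwindow₂ := recipForm_le_sum hRC₂ g hd₂
  have hsum : ∑ i ∈ Finset.range h, quadForm S (g (i + 1)) + quadForm S (g 0) =
      ∑ i ∈ Finset.range h, quadForm S (g i) + quadForm S (g h) := by
    rw [← Finset.sum_range_succ' (fun i => quadForm S (g i)),
      ← Finset.sum_range_succ (fun i => quadForm S (g i))]
  have hramp := rampSum_shift h fun i => quadForm (R₁ + R₂) (g (i + 1) - g i)
  simp only [quadForm_add, Finset.sum_add_distrib] at hramp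
  simp only [krasovskii, decreaseBound, quadForm_add, hramp]
  linarith

theorem sum_sub_dotProduct_self_le (h : ℕ) (g : ℕ → ι → ℝ) :
    ∑ i ∈ Finset.range h, (g (i + 1) - g i) ⬝ᵥ (g (i + 1) - g i) ≤
      4 * ∑ i ∈ Finset.range (h + 1), g i ⬝ᵥ g i := by
  have hsum := Finset.sum_le_sum fun i (_ : i ∈ Finset.range h) =>
    sub_dotProduct_self_le (g (i + 1)) (g i)
  rw [← Finset.mul_sum, Finset.sum_add_distrib] at hsum
  linarith [Finset.sum_range_succ (fun i => g i ⬝ᵥ g i) h,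
    Finset.sum_range_succ' (fun i => g i ⬝ᵥ g i) h, dotProduct_self_nonneg (g 0),
    dotProduct_self_nonneg (g h)]

theorem krasovskii_le [DecidableEq ι] (hR : R.PosSemidef) (g : ℕ → ι → ℝ) :
    krasovskii h P S R g ≤ (specNorm P + specNorm S + 4 * (h : ℝ) ^ 2 * specNorm R) *
      ∑ i ∈ Finset.range (h + 1), g i ⬝ᵥ g i := by
  set E := ∑ i ∈ Finset.range (h + 1), g i ⬝ᵥ g i
  have hlast : g h ⬝ᵥ g h ≤ E :=
    Finset.single_le_sum (f := fun i => g i ⬝ᵥ g i) (fun i _ => dotProduct_self_nonneg (g i))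
      (Finset.self_mem_range_succ h)
  have hpast : ∑ i ∈ Finset.range h, g i ⬝ᵥ g i ≤ E :=
    Finset.sum_le_sum_of_subset_of_nonneg (Finset.range_mono h.le_succ)
      fun i _ _ => dotProduct_self_nonneg (g i)
  have hPg : quadForm P (g h) ≤ specNorm P * E :=
    (quadForm_le_specNorm_mul P _).trans (mul_le_mul_of_nonneg_left hlast (specNorm_nonneg P))
  have hSg : ∑ i ∈ Finset.range h, quadForm S (g i) ≤ specNorm S * E :=
    calc ∑ i ∈ Finset.range h, quadForm S (g i)
        ≤ ∑ i ∈ Finset.range h, specNorm S * (g i ⬝ᵥ g i) :=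
          Finset.sum_le_sum fun i _ => quadForm_le_specNorm_mul S (g i)
      _ = specNorm S * ∑ i ∈ Finset.range h, g i ⬝ᵥ g i := (Finset.mul_sum ..).symm
      _ ≤ specNorm S * E := mul_le_mul_of_nonneg_left hpast (specNorm_nonneg S)
  have hRg : rampSum h (fun i => quadForm R (g (i + 1) - g i)) ≤ h * (specNorm R * (4 * E)) :=
    calc rampSum h (fun i => quadForm R (g (i + 1) - g i))
        ≤ h * ∑ i ∈ Finset.range h, quadForm R (g (i + 1) - g i) :=
          rampSum_le h fun i => quadForm_nonneg hR _
      _ ≤ h * ∑ i ∈ Finset.range h, specNorm R * ((g (i + 1) - g i) ⬝ᵥ (g (i + 1) - g i)) := by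
          gcongr
          exact quadForm_le_specNorm_mul R _
      _ = h * (specNorm R * ∑ i ∈ Finset.range h, (g (i + 1) - g i) ⬝ᵥ (g (i + 1) - g i)) := by
          rw [← Finset.mul_sum]
      _ ≤ h * (specNorm R * (4 * E)) := by
          gcongr
          · exact specNorm_nonneg R
          · exact sum_sub_dotProduct_self_le h g
  rw [krasovskii]
  linarith [mul_le_mul_of_nonneg_left hRg (Nat.cast_nonneg (α := ℝ) h)]

theorem exists_window_decay {c : ℝ} (hc : 0 < c) (hP : P.PosSemidef)
    (hS : S.PosSemidef) (hRC₁ : (Matrix.fromBlocks R₁ S₁ S₁ᵀ R₁).PosSemidef)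
    (hRC₂ : (Matrix.fromBlocks R₂ S₂ S₂ᵀ R₂).PosSemidef) :
    ∃ C ρ : ℝ, 0 ≤ C ∧ 0 < ρ ∧ ρ < 1 ∧ ∀ g : ℕ → ι → ℝ,
      (∀ j, ∃ d₁ ≤ h, ∃ d₂ ≤ h, c * (g (j + h) ⬝ᵥ g (j + h)) ≤
        decreaseBound h P S R₁ R₂ S₁ S₂ (g (j + h)) (g (j + d₁)) (g (j + d₂)) (g j)
          (g (j + h + 1))) →
      ∀ j, g (j + h) ⬝ᵥ g (j + h) ≤ C * ρ ^ j * ∑ i ∈ Finset.range (h + 1), g i ⬝ᵥ g i := by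
  classical
  have hR : (R₁ + R₂).PosSemidef := .add (hRC₁.submatrix Sum.inl) (hRC₂.submatrix Sum.inl)
  have hnorm : 0 ≤ specNorm P + specNorm S + 4 * (h : ℝ) ^ 2 * specNorm (R₁ + R₂) := by
    have := specNorm_nonneg P
    have := specNorm_nonneg S
    have := specNorm_nonneg (R₁ + R₂)
    positivity
  set C := specNorm P + specNorm S + 4 * (h : ℝ) ^ 2 * specNorm (R₁ + R₂) + 1
  have hC : 0 < C := by positivity
  obtain ⟨ρ, hρ₀, hρ₁, hdecay⟩ := exists_geometric_decay h hc hC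
  refine ⟨(C + c) / c, ρ, by positivity, hρ₀, hρ₁, fun g hg j => ?_⟩
  set V : ℕ → ℝ := fun j => krasovskii h P S (R₁ + R₂) fun i => g (j + i)
  have hV_step (j : ℕ) : V (j + 1) + c * (g (j + h) ⬝ᵥ g (j + h)) ≤ V j := by
    obtain ⟨d₁, hd₁, d₂, hd₂, hj⟩ := hg j
    have hstep := krasovskii_shift_add_decreaseBound_le (P := P) (S := S) hRC₁ hRC₂
      (fun i => g (j + i)) hd₁ hd₂
    simp only [V, add_right_comm j 1]
    exact (add_le_add_right hj _).trans hstep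
  have hV_le (j : ℕ) : V j ≤ C * ∑ i ∈ Finset.range (h + 1), g (j + i) ⬝ᵥ g (j + i) :=
    (krasovskii_le hR _).trans <| mul_le_mul_of_nonneg_right (lt_add_one _).le
      (Finset.sum_nonneg fun i _ => dotProduct_self_nonneg _)
  have hVj := hdecay V (fun i => g i ⬝ᵥ g i) (fun i => dotProduct_self_nonneg _) hV_step hV_le j
  have hdiss : c * (g (j + h) ⬝ᵥ g (j + h)) ≤ V j :=
    (le_add_of_nonneg_left (krasovskii_nonneg hP hS hR _)).trans (hV_step j)
  calc g (j + h) ⬝ᵥ g (j + h) ≤ V j / c := by rwa [le_div_iff₀' hc]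
    _ ≤ ((C + c) * ρ ^ j * ∑ i ∈ Finset.range (h + 1), g i ⬝ᵥ g i) / c := by gcongr
    _ = (C + c) / c * ρ ^ j * ∑ i ∈ Finset.range (h + 1), g i ⬝ᵥ g i := by ring

end Krasovskii

section Growth

variable {n m hbar : ℕ}

theorem euclNorm_eq_norm (v : Fin n → ℝ) : euclNorm v = ‖WithLp.toLp 2 v‖ := by
  rw [euclNorm, dotProduct_self_eq_norm_sq, Real.sqrt_sq (norm_nonneg _)]

theorem euclNorm_nonneg (v : Fin n → ℝ) : 0 ≤ euclNorm v := Real.sqrt_nonneg _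

theorem euclNorm_sq (v : Fin n → ℝ) : euclNorm v ^ 2 = v ⬝ᵥ v :=
  Real.sq_sqrt (dotProduct_self_nonneg v)

theorem euclNorm_add_le (v w : Fin n → ℝ) : euclNorm (v + w) ≤ euclNorm v + euclNorm w := by
  simpa only [euclNorm_eq_norm, WithLp.toLp_add]
    using norm_add_le (WithLp.toLp 2 v) (WithLp.toLp 2 w)

theorem euclNorm_mulVec_le (A : Matrix (Fin m) (Fin n) ℝ) (v : Fin n → ℝ) :
    euclNorm (A *ᵥ v) ≤ specNorm A * euclNorm v := by
  simpa only [euclNorm_eq_norm] using norm_toLp_mulVec_le A v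

theorem euclNorm_le_histNorm (z : ℤ → Fin n → ℝ) {j : ℤ} (hj : -(hbar : ℤ) ≤ j) (hj₀ : j ≤ 0) :
    euclNorm (z j) ≤ histNorm hbar z := by
  obtain ⟨i, rfl⟩ : ∃ i : ℕ, j = -(i : ℤ) := ⟨(-j).toNat, by omega⟩
  exact Finset.le_sup' (fun i : ℕ => euclNorm (z (-(i : ℤ)))) (Finset.mem_range.mpr (by omega))

theorem histNorm_nonneg (z : ℤ → Fin n → ℝ) : 0 ≤ histNorm hbar z :=
  (euclNorm_nonneg (z 0)).trans (euclNorm_le_histNorm z (by omega) le_rfl)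

variable {A₀ A₁ : Matrix (Fin n) (Fin n) ℝ} {B : Matrix (Fin n) (Fin m) ℝ}
  {K : Matrix (Fin m) (Fin n) ℝ} {η₁ η₂ : ℕ → ℕ} {x : ℤ → Fin n → ℝ} {u : ℤ → Fin m → ℝ}

theorem IsClosedLoopSolution.euclNorm_succ_le (hsol : IsClosedLoopSolution A₀ A₁ B K η₁ η₂ x u)
    {k : ℕ} (hη₁ : η₁ k ≤ hbar) (hη₂ : η₂ k ≤ hbar) {D : ℝ}
    (hx : ∀ j : ℤ, -(hbar : ℤ) ≤ j → j ≤ k → euclNorm (x j) ≤ D)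
    (hu : ∀ j : ℤ, -(hbar : ℤ) ≤ j → j ≤ 0 → euclNorm (u j) ≤ D) :
    euclNorm (x (k + 1)) ≤
      (specNorm A₀ + specNorm A₁ + specNorm B * (1 + specNorm K)) * D := by
  have hD : 0 ≤ D := (euclNorm_nonneg _).trans (hx k (by omega) le_rfl)
  have hA₀ : euclNorm (A₀ *ᵥ x k) ≤ specNorm A₀ * D :=
    (euclNorm_mulVec_le _ _).trans
      (mul_le_mul_of_nonneg_left (hx k (by omega) le_rfl) (specNorm_nonneg A₀))
  have hA₁ : euclNorm (A₁ *ᵥ x (k - η₁ k)) ≤ specNorm A₁ * D :=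
    (euclNorm_mulVec_le _ _).trans
      (mul_le_mul_of_nonneg_left (hx _ (by omega) (by omega)) (specNorm_nonneg A₁))
  have hinput : euclNorm (u (k - η₂ k)) ≤ (1 + specNorm K) * D := by
    have hKD : 0 ≤ specNorm K * D := mul_nonneg (specNorm_nonneg K) hD
    rcases le_or_gt ((k : ℤ) - η₂ k) 0 with hpast | hfeedback
    · linarith [hu _ (by omega) hpast]
    · rw [hsol.2 _ hfeedback]
      linarith [euclNorm_mulVec_le K (x (k - η₂ k)),
        mul_le_mul_of_nonneg_left (hx (k - η₂ k) (by omega) (by omega)) (specNorm_nonneg K)]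
  have hB : euclNorm (B *ᵥ u (k - η₂ k)) ≤ specNorm B * ((1 + specNorm K) * D) :=
    (euclNorm_mulVec_le _ _).trans (mul_le_mul_of_nonneg_left hinput (specNorm_nonneg B))
  rw [hsol.1 k]
  linarith [euclNorm_add_le (A₀ *ᵥ x k + A₁ *ᵥ x (k - η₁ k)) (B *ᵥ u (k - η₂ k)),
    euclNorm_add_le (A₀ *ᵥ x k) (A₁ *ᵥ x (k - η₁ k))]

variable (A₀ A₁ B K hbar) in
theorem exists_growth_bound :
    ∃ L : ℝ, 1 ≤ L ∧ ∀ η₁ η₂ : ℕ → ℕ, (∀ k, η₁ k ≤ hbar) → (∀ k, η₂ k ≤ hbar) →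
      ∀ (x : ℤ → Fin n → ℝ) (u : ℤ → Fin m → ℝ), IsClosedLoopSolution A₀ A₁ B K η₁ η₂ x u →
        ∀ (k : ℕ) (j : ℤ), -(hbar : ℤ) ≤ j → j ≤ k →
          euclNorm (x j) ≤ L ^ k * max (histNorm hbar x) (histNorm hbar u) := by
  set G := specNorm A₀ + specNorm A₁ + specNorm B * (1 + specNorm K)
  have hG : 0 ≤ G :=
    add_nonneg (add_nonneg (specNorm_nonneg A₀) (specNorm_nonneg A₁))
      (mul_nonneg (specNorm_nonneg B) (add_nonneg zero_le_one (specNorm_nonneg K)))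
  have hL : 1 ≤ 1 + G := le_add_of_nonneg_right hG
  refine ⟨1 + G, hL, fun η₁ η₂ hη₁ hη₂ x u hsol k => ?_⟩
  set D := max (histNorm hbar x) (histNorm hbar u)
  have hD : 0 ≤ D := (histNorm_nonneg x).trans (le_max_left _ _)
  induction k with
  | zero =>
    intro j hj hj₀
    rw [pow_zero, one_mul]
    exact (euclNorm_le_histNorm x hj (mod_cast hj₀)).trans (le_max_left _ _)
  | succ k ih =>
    intro j hj hjk
    have hLD : 0 ≤ (1 + G) ^ k * D := by positivity
    rw [pow_succ', mul_assoc, add_mul, one_mul]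
    rcases hjk.lt_or_eq with hlt | rfl
    · exact (ih j hj (by push_cast at hlt; omega)).trans
        (le_add_of_nonneg_right (mul_nonneg hG hLD))
    · refine (hsol.euclNorm_succ_le (hη₁ k) (hη₂ k) ih fun i hi hi₀ => ?_).trans
        (le_add_of_nonneg_left hLD)
      exact ((euclNorm_le_histNorm u hi hi₀).trans (le_max_right _ _)).trans
        (le_mul_of_one_le_left hD (one_le_pow₀ hL))

theorem euclNorm_le_of_window_decay {C ρ b : ℝ} (hC : 0 ≤ C) (hρ : 0 ≤ ρ) {z : ℕ → Fin n → ℝ}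
    {j N : ℕ} {y : Fin n → ℝ} (hz : ∀ i < N, euclNorm (z i) ≤ b) (hb : 0 ≤ b)
    (hy : y ⬝ᵥ y ≤ C * ρ ^ j * ∑ i ∈ Finset.range N, z i ⬝ᵥ z i) :
    euclNorm y ≤ √(C * N) * √ρ ^ j * b := by
  have hsum : ∑ i ∈ Finset.range N, z i ⬝ᵥ z i ≤ N * b ^ 2 :=
    calc ∑ i ∈ Finset.range N, z i ⬝ᵥ z i
        ≤ ∑ _i ∈ Finset.range N, b ^ 2 := by
          refine Finset.sum_le_sum fun i hi => ?_
          rw [← euclNorm_sq]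
          exact pow_le_pow_left₀ (euclNorm_nonneg _) (hz i (Finset.mem_range.1 hi)) 2
      _ = N * b ^ 2 := by rw [Finset.sum_const, Finset.card_range, nsmul_eq_mul]
  refine le_of_sq_le_sq ?_ (by positivity)
  calc euclNorm y ^ 2 ≤ C * ρ ^ j * (N * b ^ 2) := by
        rw [euclNorm_sq]
        exact hy.trans (by gcongr)
    _ = (√(C * N) * √ρ ^ j * b) ^ 2 := by
        rw [mul_pow, mul_pow, pow_right_comm, Real.sq_sqrt hρ, Real.sq_sqrt (by positivity)]
        ring

theorem expStable_of_window_decay {C ρ : ℝ} (hC : 0 ≤ C) (hρ₀ : 0 < ρ) (hρ₁ : ρ < 1)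
    (hdecay : ∀ η₁ η₂ : ℕ → ℕ, (∀ k, η₁ k ≤ hbar) → (∀ k, η₂ k ≤ hbar) →
      ∀ (x : ℤ → Fin n → ℝ) (u : ℤ → Fin m → ℝ), IsClosedLoopSolution A₀ A₁ B K η₁ η₂ x u →
        ∀ j : ℕ, x ↑(j + hbar + 1) ⬝ᵥ x ↑(j + hbar + 1) ≤
          C * ρ ^ j * ∑ i ∈ Finset.range (hbar + 1), x ↑(i + 1) ⬝ᵥ x ↑(i + 1)) :
    ExpStable A₀ A₁ B K hbar := by
  obtain ⟨L, hL, hgrowth⟩ := exists_growth_bound hbar A₀ A₁ B K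
  have hr₀ : 0 < √ρ := Real.sqrt_pos.2 hρ₀
  have hr₁ : √ρ < 1 := (Real.sqrt_lt' one_pos).2 (by rwa [one_pow])
  set G := √(C * ↑(hbar + 1))
  refine ⟨(G + 1) * (L / √ρ) ^ (hbar + 1), √ρ, by positivity, hr₀, hr₁,
    fun η₁ η₂ hη₁ hη₂ x u hsol k => ?_⟩
  have hx := hgrowth η₁ η₂ hη₁ hη₂ x u hsol (hbar + 1)
  set D := max (histNorm hbar x) (histNorm hbar u)
  have hD : 0 ≤ D := (histNorm_nonneg x).trans (le_max_left _ _)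
  have hLr : L ^ (hbar + 1) = (L / √ρ) ^ (hbar + 1) * √ρ ^ (hbar + 1) := by
    rw [← mul_pow, div_mul_cancel₀ _ hr₀.ne']
  rcases lt_or_ge k (hbar + 1) with hk | hk
  · calc euclNorm (x k) ≤ L ^ (hbar + 1) * D := hx k (by omega) (by omega)
      _ = 1 * (L / √ρ) ^ (hbar + 1) * √ρ ^ (hbar + 1) * D := by rw [hLr, one_mul]
      _ ≤ (G + 1) * (L / √ρ) ^ (hbar + 1) * √ρ ^ k * D := by
        gcongr ?_ * _ * ?_ * _
        · exact le_add_of_nonneg_left (Real.sqrt_nonneg _)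
        · exact pow_le_pow_of_le_one hr₀.le hr₁.le hk.le
  · obtain ⟨j, rfl⟩ := Nat.exists_eq_add_of_le' hk
    calc euclNorm (x ↑(j + (hbar + 1))) ≤ G * √ρ ^ j * (L ^ (hbar + 1) * D) :=
          euclNorm_le_of_window_decay hC hρ₀.le (fun i hi => hx _ (by omega) (by omega))
            (by positivity) (hdecay η₁ η₂ hη₁ hη₂ x u hsol j)
      _ = G * (L / √ρ) ^ (hbar + 1) * √ρ ^ (j + (hbar + 1)) * D := by
          rw [hLr, pow_add √ρ j]
          ring
      _ ≤ (G + 1) * (L / √ρ) ^ (hbar + 1) * √ρ ^ (j + (hbar + 1)) * D := by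
          gcongr
          exact le_add_of_nonneg_right zero_le_one

end Growth

section ClosedLoop

variable {n m T hbar : ℕ} {A₀ A₁ : Matrix (Fin n) (Fin n) ℝ} {B : Matrix (Fin n) (Fin m) ℝ}

theorem mulVec_inv_mulVec {F : Matrix (Fin n) (Fin n) ℝ} (hF : IsUnit F) (v : Fin n → ℝ) :
    F *ᵥ (F⁻¹ *ᵥ v) = v := by
  rw [Matrix.mulVec_mulVec, Matrix.mul_nonsing_inv _ ((Matrix.isUnit_iff_isUnit_det F).1 hF),
    Matrix.one_mulVec]

theorem IsClosedLoopSolution.mulVec_succ_eq {F : Matrix (Fin n) (Fin n) ℝ}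
    {K : Matrix (Fin m) (Fin n) ℝ} {η₁ η₂ : ℕ → ℕ} {x : ℤ → Fin n → ℝ} {u : ℤ → Fin m → ℝ}
    (hsol : IsClosedLoopSolution A₀ A₁ B K η₁ η₂ x u) (hF : IsUnit F) {k : ℕ} (hk : η₂ k < k) :
    F *ᵥ (F⁻¹ *ᵥ x (k + 1)) = (A₀ * F) *ᵥ (F⁻¹ *ᵥ x k) + (A₁ * F) *ᵥ (F⁻¹ *ᵥ x (k - η₁ k)) +
      (B * K * F) *ᵥ (F⁻¹ *ᵥ x (k - η₂ k)) := by
  simp only [← Matrix.mulVec_mulVec, mulVec_inv_mulVec hF]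
  rw [hsol.1 k, hsol.2 _ (by omega)]

theorem expStable_of_Phi_posDef {K : Matrix (Fin m) (Fin n) ℝ} {ε : ℝ}
    {X₀ Y : Matrix (Fin n) (Fin T) ℝ} {P S R₁ R₂ S₁ S₂ : Matrix (Fin n) (Fin n) ℝ}
    {Q₁ Q₂ Q₃ : Matrix (Fin T) (Fin n) ℝ} (hP : P.PosSemidef) (hS : S.PosSemidef)
    (hRC₁ : (Matrix.fromBlocks R₁ S₁ S₁ᵀ R₁).PosSemidef)
    (hRC₂ : (Matrix.fromBlocks R₂ S₂ S₂ᵀ R₂).PosSemidef)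
    (hPhi : (Phi hbar ε X₀ Y P S R₁ R₂ S₁ S₂ Q₁ Q₂ Q₃).PosDef) (hF : IsUnit (X₀ * Q₃))
    (h₃ : Y * Q₃ = A₀ * (X₀ * Q₃)) (h₂ : Y * Q₂ = A₁ * (X₀ * Q₃))
    (h₁ : Y * Q₁ = B * K * (X₀ * Q₃)) :
    ExpStable A₀ A₁ B K hbar := by
  have hR₁ : R₁.PosSemidef := hRC₁.submatrix Sum.inl
  have hR₂ : R₂.PosSemidef := hRC₂.submatrix Sum.inl
  obtain ⟨c, hc, hdissipation⟩ :=
    exists_pos_mul_le_decreaseBound hR₁.isHermitian hR₂.isHermitian hPhi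
  obtain ⟨C, ρ, hC, hρ₀, hρ₁, hdecay⟩ := exists_window_decay (h := hbar) hc hP hS hRC₁ hRC₂
  set F := X₀ * Q₃
  refine expStable_of_window_decay (C := specNorm F ^ 2 * C * specNorm F⁻¹ ^ 2) (by positivity)
    hρ₀ hρ₁ fun η₁ η₂ hη₁ hη₂ x u hsol j => ?_
  set ξ : ℕ → Fin n → ℝ := fun i => F⁻¹ *ᵥ x ↑(i + 1)
  have hξ_step (j : ℕ) : F *ᵥ ξ (j + hbar + 1) = (Y * Q₃) *ᵥ ξ (j + hbar) +
      (Y * Q₂) *ᵥ ξ (j + (hbar - η₁ (j + hbar + 1))) +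
      (Y * Q₁) *ᵥ ξ (j + (hbar - η₂ (j + hbar + 1))) := by
    have hη₁j := hη₁ (j + hbar + 1)
    have hη₂j := hη₂ (j + hbar + 1)
    have htime₁ : (↑(j + (hbar - η₁ (j + hbar + 1)) + 1) : ℤ) =
        ↑(j + hbar + 1) - ↑(η₁ (j + hbar + 1)) := by omega
    have htime₂ : (↑(j + (hbar - η₂ (j + hbar + 1)) + 1) : ℤ) =
        ↑(j + hbar + 1) - ↑(η₂ (j + hbar + 1)) := by omega
    simp only [ξ, htime₁, htime₂, h₁, h₂, h₃]
    exact hsol.mulVec_succ_eq hF (by omega)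
  have hξ := hdecay ξ (fun j => ⟨_, Nat.sub_le .., _, Nat.sub_le ..,
    hdissipation _ _ _ _ _ (hξ_step j)⟩) j
  have hFξ : F *ᵥ ξ (j + hbar) = x ↑(j + hbar + 1) := mulVec_inv_mulVec hF _
  calc x ↑(j + hbar + 1) ⬝ᵥ x ↑(j + hbar + 1)
      ≤ specNorm F ^ 2 * (ξ (j + hbar) ⬝ᵥ ξ (j + hbar)) := by
        rw [← hFξ]
        exact mulVec_dotProduct_mulVec_le F _
    _ ≤ specNorm F ^ 2 * (C * ρ ^ j * ∑ i ∈ Finset.range (hbar + 1),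
          specNorm F⁻¹ ^ 2 * (x ↑(i + 1) ⬝ᵥ x ↑(i + 1))) := by
        gcongr
        exact hξ.trans (by gcongr; exact mulVec_dotProduct_mulVec_le F⁻¹ _)
    _ = specNorm F ^ 2 * C * specNorm F⁻¹ ^ 2 * ρ ^ j *
          ∑ i ∈ Finset.range (hbar + 1), x ↑(i + 1) ⬝ᵥ x ↑(i + 1) := by
        rw [← Finset.mul_sum]
        ring

end ClosedLoop

section Data

variable {n m T hbar h₁ h₂ : ℕ} {A₀ A₁ : Matrix (Fin n) (Fin n) ℝ} {B : Matrix (Fin n) (Fin m) ℝ}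

theorem dataMat_congr {z w : ℤ → Fin n → ℝ} {i : ℤ} (h : ∀ k, i ≤ k → k < i + T → z k = w k) :
    dataMat z i T = dataMat w i T := by
  ext r c
  exact congrFun (h (i + c) (by omega) (by omega)) r

theorem sysMat_mul_dataW (A₀ A₁ : Matrix (Fin n) (Fin n) ℝ) (B : Matrix (Fin n) (Fin m) ℝ)
    (x : ℤ → Fin n → ℝ) (u : ℤ → Fin m → ℝ) :
    sysMat A₀ A₁ B * dataW u x h₁ h₂ T = A₀ * dataMat x 0 T + A₁ * dataMat (delayed x h₁) 0 T +
      B * dataMat (delayed u h₂) 0 T := by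
  rw [sysMat, dataW, Matrix.fromCols_mul_fromRows, Matrix.fromCols_mul_fromRows]
  abel

theorem IsTrajectoryOn.dataMat_one_eq {x : ℤ → Fin n → ℝ} {u : ℤ → Fin m → ℝ}
    (h : IsTrajectoryOn A₀ A₁ B h₁ h₂ T x u) :
    dataMat x 1 T = A₀ * dataMat x 0 T + A₁ * dataMat (delayed x h₁) 0 T +
      B * dataMat (delayed u h₂) 0 T := by
  ext r c
  have hc := congrFun (h c c.2) r
  simp only [dataMat, delayed, Matrix.add_apply, Matrix.mul_apply, Matrix.of_apply, zero_add,
    add_comm (1 : ℤ)]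
  exact hc

theorem dataMat_one_eq_of_noise (hh₁ : h₁ ≤ hbar) (hh₂ : h₂ ≤ hbar)
    {x xnom xδ : ℤ → Fin n → ℝ} {u unom uδ : ℤ → Fin m → ℝ}
    (hx : ∀ k : ℤ, -(hbar : ℤ) ≤ k → k ≤ T → x k = xnom k + xδ k)
    (hu : ∀ k : ℤ, -(hbar : ℤ) ≤ k → k ≤ T → u k = unom k + uδ k)
    (hnom : IsTrajectoryOn A₀ A₁ B h₁ h₂ T xnom unom) :
    dataMat x 1 T = A₀ * dataMat x 0 T + A₁ * dataMat (delayed x h₁) 0 T +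
      B * dataMat (delayed u h₂) 0 T - mismatch A₀ A₁ B h₁ h₂ T xδ uδ := by
  have hX₁ : dataMat x 1 T = dataMat xnom 1 T + dataMat xδ 1 T :=
    dataMat_congr fun k _ _ => hx k (by omega) (by omega)
  have hX₀ : dataMat x 0 T = dataMat xnom 0 T + dataMat xδ 0 T :=
    dataMat_congr fun k _ _ => hx k (by omega) (by omega)
  have hXₕ : dataMat (delayed x h₁) 0 T =
      dataMat (delayed xnom h₁) 0 T + dataMat (delayed xδ h₁) 0 T :=
    dataMat_congr fun k _ _ => hx (k - h₁) (by omega) (by omega)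
  have hU : dataMat (delayed u h₂) 0 T =
      dataMat (delayed unom h₂) 0 T + dataMat (delayed uδ h₂) 0 T :=
    dataMat_congr fun k _ _ => hu (k - h₂) (by omega) (by omega)
  rw [hX₁, hX₀, hXₕ, hU, mismatch, sysMat_mul_dataW, hnom.dataMat_one_eq]
  simp only [Matrix.mul_add]
  abel

end Data

end DelayControl

open DelayControl in
theorem theorem2_general {n m T hbar : ℕ} {A₀ A₁ : Matrix (Fin n) (Fin n) ℝ}
    {B : Matrix (Fin n) (Fin m) ℝ} {X₀ X₁ Xₕ Δ : Matrix (Fin n) (Fin T) ℝ}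
    {U : Matrix (Fin m) (Fin T) ℝ} (hX₁ : X₁ = A₀ * X₀ + A₁ * Xₕ + B * U - Δ)
    {α ε lam : ℝ} (hΔ : specNorm Δ ≤ α) {P S R₁ R₂ S₁ S₂ : Matrix (Fin n) (Fin n) ℝ}
    {Q₁ Q₂ Q₃ : Matrix (Fin T) (Fin n) ℝ} (hP : P.PosSemidef) (hS : S.PosSemidef) (hlam : 0 ≤ lam)
    (hLMI : (augmented α lam (Phi hbar ε X₀ X₁ P S R₁ R₂ S₁ S₂ Q₁ Q₂ Q₃)
      (bigQ ε Q₁ Q₂ Q₃)).PosDef)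
    (hRC₁ : (Matrix.fromBlocks R₁ S₁ S₁ᵀ R₁).PosSemidef)
    (hRC₂ : (Matrix.fromBlocks R₂ S₂ S₂ᵀ R₂).PosSemidef)
    (hUQ₂ : U * Q₂ = 0) (hUQ₃ : U * Q₃ = 0) (hXhQ₁ : Xₕ * Q₁ = 0) (hXhQ₃ : Xₕ * Q₃ = 0)
    (hXQ₁ : X₀ * Q₁ = 0) (hXQ₂ : X₀ * Q₂ = 0) (hXhQ₂ : Xₕ * Q₂ = X₀ * Q₃) :
    IsUnit (X₀ * Q₃) ∧ ExpStable A₀ A₁ B (U * Q₁ * (X₀ * Q₃)⁻¹) hbar := by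
  have hPhi := Phi_posDef_of_augmented_posDef hlam hΔ hLMI
  have htrue : X₁ + Δ = A₀ * X₀ + A₁ * Xₕ + B * U := by rw [hX₁, sub_add_cancel]
  have hF : IsUnit (X₀ * Q₃) :=
    isUnit_of_Phi_posDef hP (hRC₁.submatrix Sum.inl) (hRC₂.submatrix Sum.inl) hPhi
  have hdet := (Matrix.isUnit_iff_isUnit_det _).1 hF
  refine ⟨hF, expStable_of_Phi_posDef hP hS hRC₁ hRC₂ hPhi hF ?_ ?_ ?_⟩ <;>
    simp only [htrue, Matrix.add_mul, Matrix.mul_assoc, Matrix.nonsing_inv_mul _ hdet, hUQ₂, hUQ₃,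
      hXhQ₁, hXhQ₂, hXhQ₃, hXQ₁, hXQ₂, Matrix.mul_zero, Matrix.mul_one, add_zero, zero_add]

theorem theorem2 {n m T hbar h₁ h₂ : ℕ}
    (hbar_pos : 0 < hbar) (hT : hbar < T) (hh₁ : h₁ ≤ hbar) (hh₂ : h₂ ≤ hbar)
    (A₀ A₁ : Matrix (Fin n) (Fin n) ℝ) (B : Matrix (Fin n) (Fin m) ℝ)
    -- recorded data `x`, `u`: a nominal trajectory plus noise
    (x xnom xδ : ℤ → Fin n → ℝ) (u unom uδ : ℤ → Fin m → ℝ)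
    (hx : ∀ k : ℤ, -(hbar : ℤ) ≤ k → k ≤ T → x k = xnom k + xδ k)
    (hu : ∀ k : ℤ, -(hbar : ℤ) ≤ k → k ≤ T → u k = unom k + uδ k)
    (hnom : DelayControl.IsTrajectoryOn A₀ A₁ B h₁ h₂ T xnom unom)
    (hrank : (DelayControl.dataW u x h₁ h₂ T).rank = m + 2 * n)
    -- bound on the mismatch
    (α : ℝ) (hα : 0 < α)
    (hΔ : DelayControl.specNorm (DelayControl.mismatch A₀ A₁ B h₁ h₂ T xδ uδ) ≤ α)
    -- feasibility of the matrix inequalities and equality constraints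
    (ε : ℝ) (hε : 0 < ε)
    (P S R₁ R₂ S₁ S₂ : Matrix (Fin n) (Fin n) ℝ) (Q₁ Q₂ Q₃ : Matrix (Fin T) (Fin n) ℝ) (lam : ℝ)
    (hP : P.PosDef) (hS : S.PosDef) (hR₁ : R₁.PosDef) (hR₂ : R₂.PosDef) (hlam : 0 < lam)
    (hLMI : (DelayControl.augmented α lam
      (DelayControl.Phi hbar ε (DelayControl.dataMat x 0 T) (DelayControl.dataMat x 1 T)
        P S R₁ R₂ S₁ S₂ Q₁ Q₂ Q₃)
      (DelayControl.bigQ ε Q₁ Q₂ Q₃)).PosDef)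
    (hRC₁ : (Matrix.fromBlocks R₁ S₁ S₁ᵀ R₁).PosSemidef)
    (hRC₂ : (Matrix.fromBlocks R₂ S₂ S₂ᵀ R₂).PosSemidef)
    (hUQ₂ : DelayControl.dataMat (DelayControl.delayed u h₂) 0 T * Q₂ = 0)
    (hUQ₃ : DelayControl.dataMat (DelayControl.delayed u h₂) 0 T * Q₃ = 0)
    (hXhQ₁ : DelayControl.dataMat (DelayControl.delayed x h₁) 0 T * Q₁ = 0)
    (hXhQ₃ : DelayControl.dataMat (DelayControl.delayed x h₁) 0 T * Q₃ = 0)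
    (hXQ₁ : DelayControl.dataMat x 0 T * Q₁ = 0)
    (hXQ₂ : DelayControl.dataMat x 0 T * Q₂ = 0)
    (hXhQ₂ : DelayControl.dataMat (DelayControl.delayed x h₁) 0 T * Q₂ =
      DelayControl.dataMat x 0 T * Q₃)
    -- the feedback gain
    (K : Matrix (Fin m) (Fin n) ℝ)
    (hK : K = DelayControl.dataMat (DelayControl.delayed u h₂) 0 T * Q₁ *
      (DelayControl.dataMat x 0 T * Q₃)⁻¹) :
    IsUnit (DelayControl.dataMat x 0 T * Q₃) ∧ DelayControl.ExpStable A₀ A₁ B K hbar := by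
  subst hK
  exact theorem2_general (DelayControl.dataMat_one_eq_of_noise hh₁ hh₂ hx hu hnom) hΔ
    hP.posSemidef hS.posSemidef hlam.le hLMI hRC₁ hRC₂ hUQ₂ hUQ₃ hXhQ₁ hXhQ₃ hXQ₁ hXQ₂ hXhQ₂
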